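/- Let $d\ge 1$ and let $G$ be the $d$-dimensional unweighted grid graph with $n_j$ layers in dimension $j$: its nodes are the integer vectors $\mathbf x=[x_1,\dots,x_d]$ with $1\le x_j\le n_j$, and two nodes are linked if and only if they differ by exactly $1$ in one coordinate and agree in all others. Assume that $G$ has at least one inner node, i.e. a node with $1<x_j<n_j$ for all $j$. Let $S$ be the adjacency matrix, $D$ the diagonal matrix of the degrees, $L=D-S$, and $\mathfrak L=D^{-1/2}LD^{-1/2}$ the normalized Laplacian. For an integer vector $\mathbf z=[z_1,\dots,z_d]$ with $0\le z_j<n_j$ consider the system of $d+1$ equations $$2d\,\lambda=\sum_{j=1}^d\Bigl(2+2\cos\tfrac{z_j\pi-2\delta_j}{n_j-1}\Bigr),\qquad \lambda=1+\cos\tfrac{z_l\pi-2\delta_l}{n_l-1}+\tan(\delta_l)\,\sin\tfrac{z_l\pi-2\delta_l}{n_l-1}\quad(l=1,\dots,d)$$ for real $\lambda$ and $\boldsymbol\delta=(\delta_1,\dots,\delta_d)$ with $\cos\delta_l\ne0$ for all $l$, and put $$\nu_{\mathbf z,\boldsymbol\delta}(\mathbf x)=D_{\mathbf x,\mathbf x}^{1/2}\prod_{j=1}^d(-1)^{x_j}\cos\Bigl(\tfrac{x_j-1}{n_j-1}(z_j\pi-2\delta_j)+\delta_j\Bigr).$$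 (1) For every $\mathbf z$ and every solution $(\lambda,\boldsymbol\delta)$ of its system, $\lambda=1+\frac1d\sum_{j=1}^d\cos\bigl(\frac{1}{n_j-1}(z_j\pi-2\delta_j)\bigr)$, and $\nu_{\mathbf z,\boldsymbol\delta}$ is an eigenvector of $\mathfrak L$ (in particular nonzero) for the eigenvalue $\lambda$. (2) If $(\lambda',\boldsymbol\delta')$ and $(\lambda'',\boldsymbol\delta'')$ solve the systems of $\mathbf z'$ and $\mathbf z''$, then $\nu_{\mathbf z',\boldsymbol\delta'}$ and $\nu_{\mathbf z'',\boldsymbol\delta''}$ are orthogonal or proportional (whether or not $\lambda'=\lambda''$). (3) For every $\mathbf z$ there is exactly one real $\lambda=\lambda_{\mathbf z}$ for which the system has a solution $(\lambda,\boldsymbol\delta)$ with $-\pi/2<\delta_j<\pi/2$ for all $j$. (4) If for every $\mathbf z$ a solution $(\lambda_{\mathbf z},\boldsymbol\delta^{\mathbf z})$ with $-\pi/2<\delta^{\mathbf z}_j<\pi/2$ for all $j$ is chosen, then the eigenvectors $\nu_{\mathbf z,\boldsymbol\delta^{\mathbf z}}$ are pairwise orthogonal for distinct $\mathbf z$ (also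 when the eigenvalues are equal), they form a basis of the space of all real vectors indexed by the nodes, and the eigenvalues of $\mathfrak L$ are exactly the numbers $\lambda_{\mathbf z}$. -/

import Mathlib

open scoped Matrix BigOperators

noncomputable section

/-- Vectors `[x₁, …, x_d]` with one entry for each of the `n j` layers in dimension `j`. Entries are
counted from `0`: the entry `a : Fin (n j)` of a node stands for the layer `x_j = a + 1`, and the
entry `a` of an eigen identity vector stands for `z_j = a`, so that `0 ≤ z_j < n_j`. -/
abbrev GridVec {d : ℕ} (n : Fin d → ℕ) : Type := (j : Fin d) → Fin (n j)

/-- The `d`-dimensional grid graph with `n j` layers in dimension `j` (the Cartesian product of the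
paths with `n j` nodes): two nodes are linked iff they differ by one in exactly one coordinate and
agree in all the others. -/
def gridGraph {d : ℕ} (n : Fin d → ℕ) : SimpleGraph (GridVec n) where
  Adj x y := ∃ j, ((x j : ℕ) + 1 = y j ∨ (y j : ℕ) + 1 = x j) ∧ ∀ i, i ≠ j → x i = y i
  symm := ⟨fun _ _ ⟨j, h, h'⟩ => ⟨j, h.symm, fun i hi => (h' i hi).symm⟩⟩
  loopless := ⟨fun _ ⟨_, h, _⟩ => by omega⟩

instance {d : ℕ} (n : Fin d → ℕ) : DecidableRel (gridGraph n).Adj := fun x y =>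
  inferInstanceAs (Decidable
    (∃ j, ((x j : ℕ) + 1 = y j ∨ (y j : ℕ) + 1 = x j) ∧ ∀ i, i ≠ j → x i = y i))

/-- A node is inner if it has two neighbours in each dimension, `1 < x_j < n_j`. -/
def IsInnerNode {d : ℕ} {n : Fin d → ℕ} (x : GridVec n) : Prop :=
  ∀ j, 0 < (x j : ℕ) ∧ (x j : ℕ) + 1 < n j

/-- The normalized Laplacian `D^{-1/2} L D^{-1/2}`, where `D` is the diagonal matrix of the degrees
and `L = D - S` is the combinatorial Laplacian. -/
def gridNormLaplacian {d : ℕ} (n : Fin d → ℕ) : Matrix (GridVec n) (GridVec n) ℝ :=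
  Matrix.diagonal (fun x => (√((gridGraph n).degree x : ℝ))⁻¹) * (gridGraph n).lapMatrix ℝ *
    Matrix.diagonal (fun x => (√((gridGraph n).degree x : ℝ))⁻¹)

/-- The angle `(z_j π - 2 δ_j) / (n_j - 1)`. -/
def gridAngle {d : ℕ} {n : Fin d → ℕ} (z : GridVec n) (δ : Fin d → ℝ) (j : Fin d) : ℝ :=
  (((z j : ℕ) : ℝ) * Real.pi - 2 * δ j) / ((n j : ℝ) - 1)

/-- `(lam, δ)` solves the system of `d + 1` equations that belongs to `z`; that `cos (δ l) ≠ 0` says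
that the tangent in the equation number `l` is defined. -/
def IsShiftSolution {d : ℕ} {n : Fin d → ℕ} (z : GridVec n) (lam : ℝ) (δ : Fin d → ℝ) : Prop :=
  2 * (d : ℝ) * lam = ∑ j, (2 + 2 * Real.cos (gridAngle z δ j)) ∧
    ∀ l, Real.cos (δ l) ≠ 0 ∧
      lam = 1 + Real.cos (gridAngle z δ l) + Real.tan (δ l) * Real.sin (gridAngle z δ l)

/-- The vector with components
`D_{x,x}^{1/2} ∏_j (-1)^{x_j} cos ((x_j - 1) / (n_j - 1) * (z_j π - 2 δ_j) + δ_j)`;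
recall that `x_j` is the entry `x j` plus one. -/
def gridEigenvector {d : ℕ} {n : Fin d → ℕ} (z : GridVec n) (δ : Fin d → ℝ) : GridVec n → ℝ :=
  fun x => √((gridGraph n).degree x : ℝ) *
    ∏ j, (-1 : ℝ) ^ ((x j : ℕ) + 1) *
      Real.cos (((x j : ℕ) : ℝ) * gridAngle z δ j + δ j)

end

/-!
The grid is a product of paths, so `D ^ (1/2) u` with a product `u = ∏ f_j (x_j)` is an eigenvector of
the normalized Laplacian for `lam` as soon as each `f_j` is an eigenvector, for some eigenvalue
`c_j`, of the tridiagonal matrix `A - (1 - lam) D` of the path number `j` and `∑ c_j = 0`. The wave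
`(-1)^x cos ((x - 1) θ + δ)` has this property with `c = 2 (lam - 1) - 2 cos θ`
(`sum_pathAdj_shiftWave`): inside the path for every `θ` and `δ`, and at the ends by the equation for
`lam`. The first equation of the system says that `∑ c_j = 0`.

Two such eigenvectors for the same `lam` have a dot product `∑_i ∏_j p_ij`, where `p_ij` for `j ≠ i`
is the dot product of the factors on the path number `j`, which vanishes if their `c_j` differ. If
the `c_j` are not all the same, they differ for at least two `j`, as both families have the sum `0`,
and the dot product is `0` (`gridEigenvector_orthogonal_of_cos_ne`). If they are all the same, the
factors satisfy the same recurrences and the eigenvectors are proportional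
(`gridEigenvector_proportional`). With shifts in `(-π/2, π/2)` the latter happens only for `z = z'`,
as `lam` and `cos θ` then determine `z` (`nat_eq_of_cos_eq`).

For the existence of solutions (`exists_isShiftSolution`), each equation `l = 1, …, d` is solved for
the shift by the intermediate value theorem for every `lam` in `[0, 2]`, in such a way that `cos θ_l`
is monotone in `lam`. The remaining equation is a fixed point equation for a monotone map of `[0, 2]`
into itself, which has a solution by the theorem of Knaster and Tarski. One solution for each `z`
gives as many orthogonal nonzero vectors as there are nodes, so they form a basis; hence there are no
further eigenvalues, and a second `lam` for the same `z` is impossible because its eigenvector would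
be orthogonal to the whole basis.
-/

noncomputable section

/-! ### Paths -/

/-- The adjacency matrix of the path with nodes `0, …, m - 1`. -/
def pathAdj {m : ℕ} (a b : Fin m) : ℝ :=
  if (a : ℕ) + 1 = b ∨ (b : ℕ) + 1 = a then 1 else 0

/-- The degree of a node of the path with nodes `0, …, m - 1`. -/
def pathDeg {m : ℕ} (a : Fin m) : ℝ := ∑ b, pathAdj a b

theorem pathAdj_symm {m : ℕ} (a b : Fin m) : pathAdj a b = pathAdj b a := by
  unfold pathAdj
  simp only [or_comm]

/-- The sum over the neighbours in the path; each of the two terms is present if the neighbour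
exists. -/
theorem sum_pathAdj_mul {m : ℕ} (a : Fin m) (F : ℕ → ℝ) :
    ∑ b : Fin m, pathAdj a b * F b =
      (if (a : ℕ) + 1 < m then F (a + 1) else 0) + (if 0 < (a : ℕ) then F (a - 1) else 0) := by
  have h1 : ∀ b : Fin m, pathAdj a b * F b =
      (if (a : ℕ) + 1 = b then F (a + 1) else 0) +
        (if 0 < (a : ℕ) ∧ (a : ℕ) - 1 = b then F (a - 1) else 0) := by
    intro b
    unfold pathAdj
    rcases lt_trichotomy ((a : ℕ) + 1) b with h | h | h
    · rw [if_neg (by omega), if_neg (by omega), if_neg (by omega)]; simp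
    · rw [if_pos (by omega), if_pos h, if_neg (by omega), h]; simp
    · by_cases h2 : (b : ℕ) + 1 = a
      · rw [if_pos (by omega), if_neg (by omega), if_pos (by omega)]
        rw [show (a : ℕ) - 1 = b by omega]; simp
      · rw [if_neg (by omega), if_neg (by omega), if_neg (by omega)]; simp
  simp_rw [h1]
  rw [Finset.sum_add_distrib,
    Fin.sum_univ_eq_sum_range (fun k => if (a : ℕ) + 1 = k then F (a + 1) else 0) m,
    Fin.sum_univ_eq_sum_range
      (fun k => if 0 < (a : ℕ) ∧ (a : ℕ) - 1 = k then F (a - 1) else 0) m]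
  have ha := a.2
  congr 1
  · rw [Finset.sum_ite_eq]; simp
  · by_cases h0 : 0 < (a : ℕ)
    · simp only [h0, true_and, if_true]
      rw [Finset.sum_ite_eq, if_pos (by simp; omega)]
    · simp [h0]

theorem pathDeg_eq {m : ℕ} (a : Fin m) :
    pathDeg a = (if (a : ℕ) + 1 < m then 1 else 0) + (if 0 < (a : ℕ) then 1 else 0) := by
  have := sum_pathAdj_mul a (fun _ => (1 : ℝ))
  simpa [pathDeg] using this

theorem one_le_pathDeg {m : ℕ} (hm : 2 ≤ m) (a : Fin m) : 1 ≤ pathDeg a := by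
  rw [pathDeg_eq]
  by_cases h : 0 < (a : ℕ)
  · rw [if_pos h]; split_ifs <;> norm_num
  · rw [if_neg h, if_pos (by omega)]; norm_num

/-! ### Waves on a path -/

/-- The factor `(-1)^x cos ((x - 1) θ + δ)` of the eigenvectors at `x = k + 1`. -/
def shiftWave (θ δ : ℝ) (k : ℕ) : ℝ := (-1) ^ (k + 1) * Real.cos ((k : ℝ) * θ + δ)

theorem shiftWave_add_two (θ δ : ℝ) (k : ℕ) :
    shiftWave θ δ (k + 2) = -2 * Real.cos θ * shiftWave θ δ (k + 1) - shiftWave θ δ k := by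
  have h2 : Real.cos (((k + 2 : ℕ) : ℝ) * θ + δ) =
      2 * Real.cos θ * Real.cos (((k + 1 : ℕ) : ℝ) * θ + δ) - Real.cos ((k : ℝ) * θ + δ) := by
    rw [show ((k + 2 : ℕ) : ℝ) * θ + δ = (((k + 1 : ℕ) : ℝ) * θ + δ) + θ by push_cast; ring,
      show (k : ℝ) * θ + δ = (((k + 1 : ℕ) : ℝ) * θ + δ) - θ by push_cast; ring,
      Real.cos_add, Real.cos_sub]
    ring
  unfold shiftWave
  rw [h2, pow_succ _ (k + 2), pow_succ _ (k + 1), pow_succ _ k]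
  ring

/-- The equation for `lam` in the form of a boundary condition for the wave. -/
theorem cos_add_eq_of_shift {lam θ δ : ℝ} (hδ : Real.cos δ ≠ 0)
    (hlam : lam = 1 + Real.cos θ + Real.tan δ * Real.sin θ) :
    Real.cos (θ + δ) = (2 * Real.cos θ - (lam - 1)) * Real.cos δ := by
  have : Real.tan δ * Real.cos δ = Real.sin δ := Real.tan_mul_cos hδ
  rw [Real.cos_add, hlam, ← this]
  ring

/-- On a path, the factor is an eigenvector of `A - (1 - lam) D`; the equation for `lam` is what is
needed at the two ends. -/
theorem sum_pathAdj_shiftWave {m : ℕ} (hm : 2 ≤ m) {lam θ δ : ℝ} {z : ℕ}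
    (hθ : ((m : ℝ) - 1) * θ = z * Real.pi - 2 * δ) (hδ : Real.cos δ ≠ 0)
    (hlam : lam = 1 + Real.cos θ + Real.tan δ * Real.sin θ) (a : Fin m) :
    ∑ b : Fin m, pathAdj a b * shiftWave θ δ b =
      ((1 - lam) * pathDeg a + (2 * (lam - 1) - 2 * Real.cos θ)) * shiftWave θ δ a := by
  have hc := cos_add_eq_of_shift hδ hlam
  have ha := a.2
  rw [sum_pathAdj_mul, pathDeg_eq]
  generalize (a : ℕ) = k at *
  rcases Nat.eq_zero_or_pos k with rfl | hk
  · have h1 : 0 + 1 < m := by omega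
    simp only [h1, if_true, lt_irrefl, if_false, shiftWave]
    simp only [zero_add, Nat.cast_one, one_mul, Nat.cast_zero, zero_mul]
    rw [hc]; ring
  · obtain ⟨k, rfl⟩ : ∃ k', k = k' + 1 := ⟨k - 1, by omega⟩
    rw [if_pos hk, if_pos hk, Nat.add_sub_cancel]
    by_cases hl : k + 1 + 1 < m
    · rw [if_pos hl, if_pos hl, shiftWave_add_two]; ring
    · rw [if_neg hl, if_neg hl]
      have hmk : m = k + 2 := by omega
      subst hmk
      -- the reflection of the path maps the wave to `(-1) ^ z` times itself, up to sign
      have e1 : Real.cos (((k + 1 : ℕ) : ℝ) * θ + δ) = (-1) ^ z * Real.cos δ := by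
        rw [show ((k + 1 : ℕ) : ℝ) * θ + δ = z * Real.pi - δ by
          push_cast at hθ ⊢; linarith, Real.cos_nat_mul_pi_sub]
      have e2 : Real.cos ((k : ℝ) * θ + δ) = (-1) ^ z * Real.cos (θ + δ) := by
        rw [show (k : ℝ) * θ + δ = z * Real.pi - (θ + δ) by
          push_cast at hθ ⊢; linarith, Real.cos_nat_mul_pi_sub]
      unfold shiftWave
      rw [e1, e2, hc, pow_succ _ (k + 1)]
      ring

/-- By the symmetry of `A - (1 - lam) D` on a path, its eigenvectors for different eigenvalues are
orthogonal. -/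
theorem sum_shiftWave_mul_eq_zero {m : ℕ} (hm : 2 ≤ m) {lam θ δ θ' δ' : ℝ} {z z' : ℕ}
    (hθ : ((m : ℝ) - 1) * θ = z * Real.pi - 2 * δ) (hδ : Real.cos δ ≠ 0)
    (hlam : lam = 1 + Real.cos θ + Real.tan δ * Real.sin θ)
    (hθ' : ((m : ℝ) - 1) * θ' = z' * Real.pi - 2 * δ') (hδ' : Real.cos δ' ≠ 0)
    (hlam' : lam = 1 + Real.cos θ' + Real.tan δ' * Real.sin θ')
    (hne : Real.cos θ ≠ Real.cos θ') :
    ∑ a : Fin m, shiftWave θ δ a * shiftWave θ' δ' a = 0 := by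
  have hswap : ∑ a : Fin m, shiftWave θ' δ' a * ∑ b : Fin m, pathAdj a b * shiftWave θ δ b =
      ∑ a : Fin m, shiftWave θ δ a * ∑ b : Fin m, pathAdj a b * shiftWave θ' δ' b := by
    simp_rw [Finset.mul_sum]
    rw [Finset.sum_comm]
    refine Finset.sum_congr rfl fun a _ => Finset.sum_congr rfl fun b _ => ?_
    rw [pathAdj_symm b a]; ring
  simp_rw [sum_pathAdj_shiftWave hm hθ hδ hlam, sum_pathAdj_shiftWave hm hθ' hδ' hlam'] at hswap
  rw [← sub_eq_zero, ← Finset.sum_sub_distrib] at hswap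
  have : ∑ a : Fin m, (2 * (Real.cos θ' - Real.cos θ)) * (shiftWave θ δ a * shiftWave θ' δ' a)
      = 0 := by
    rw [← hswap]
    exact Finset.sum_congr rfl fun a _ => by ring
  rw [← Finset.mul_sum] at this
  refine (mul_eq_zero.mp this).resolve_left ?_
  exact mul_ne_zero two_ne_zero (sub_ne_zero.mpr hne.symm)

/-- `lam` and `cos θ` determine the factor up to scaling, as they determine the recurrence and its
first step. -/
theorem cos_mul_shiftWave_eq {lam θ δ θ' δ' : ℝ} (hδ : Real.cos δ ≠ 0)
    (hlam : lam = 1 + Real.cos θ + Real.tan δ * Real.sin θ) (hδ' : Real.cos δ' ≠ 0)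
    (hlam' : lam = 1 + Real.cos θ' + Real.tan δ' * Real.sin θ')
    (heq : Real.cos θ = Real.cos θ') (k : ℕ) :
    Real.cos δ * shiftWave θ' δ' k = Real.cos δ' * shiftWave θ δ k := by
  induction k using Nat.twoStepInduction with
  | zero => simp [shiftWave]; ring
  | one =>
    simp only [shiftWave, Nat.cast_one, one_mul]
    rw [cos_add_eq_of_shift hδ hlam, cos_add_eq_of_shift hδ' hlam', heq]
    ring
  | more k h0 h1 =>
    rw [shiftWave_add_two, shiftWave_add_two, heq]
    linear_combination (-2 * Real.cos θ') * h1 - h0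

/-- The angles that belong to shifts in `(-π/2, π/2)` lie in an interval of length `2 π`. -/
theorem shift_angle_mem_Ioo {m : ℕ} (hm : 3 ≤ m) {θ δ : ℝ} {z : ℕ} (hz : z < m)
    (hθ : ((m : ℝ) - 1) * θ = z * Real.pi - 2 * δ) (hδ : |δ| < Real.pi / 2) :
    θ ∈ Set.Ioo (-(Real.pi / 2)) (3 * Real.pi / 2) := by
  have hπ := Real.pi_pos
  obtain ⟨hδ1, hδ2⟩ := abs_lt.mp hδ
  have hm' : (3 : ℝ) ≤ m := by exact_mod_cast hm
  have hz' : (z : ℝ) + 1 ≤ m := by exact_mod_cast hz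
  have hz0 : (0 : ℝ) ≤ z := Nat.cast_nonneg z
  have hzπ : (z : ℝ) * Real.pi ≤ (m - 1) * Real.pi :=
    mul_le_mul_of_nonneg_right (by linarith) hπ.le
  have hzπ0 : 0 ≤ (z : ℝ) * Real.pi := by positivity
  constructor
  · by_contra! h
    nlinarith
  · by_contra! h
    nlinarith

theorem shift_angle_of_sin_eq_zero {m : ℕ} (hm : 3 ≤ m) {θ δ : ℝ} {z : ℕ} (hz : z < m)
    (hθ : ((m : ℝ) - 1) * θ = z * Real.pi - 2 * δ) (hδ : |δ| < Real.pi / 2)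
    (hs : Real.sin θ = 0) : θ = 0 ∧ z = 0 ∨ θ = Real.pi ∧ z + 1 = m := by
  have hπ := Real.pi_pos
  obtain ⟨h1, h2⟩ := shift_angle_mem_Ioo hm hz hθ hδ
  obtain ⟨hδ1, hδ2⟩ := abs_lt.mp hδ
  obtain ⟨k, rfl⟩ := Real.sin_eq_zero_iff.mp hs
  have hk1 : (-1 : ℝ) < k := by by_contra! h; nlinarith
  have hk2 : (k : ℝ) < 2 := by by_contra! h; nlinarith
  have hk1' : -1 < k := by exact_mod_cast hk1
  have hk2' : k < 2 := by exact_mod_cast hk2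
  obtain rfl | rfl : k = 0 ∨ k = 1 := by omega
  · left
    refine ⟨by simp, ?_⟩
    have : (z : ℝ) < 1 := by by_contra! h; push_cast at hθ; nlinarith
    have : z < 1 := by exact_mod_cast this
    omega
  · right
    refine ⟨by simp, ?_⟩
    have : (m : ℝ) < z + 2 := by by_contra! h; push_cast at hθ; nlinarith
    have : m < z + 2 := by exact_mod_cast this
    omega

/-- For shifts in `(-π/2, π/2)`, the numbers `lam` and `cos θ` determine `z`. -/
theorem nat_eq_of_cos_eq {m : ℕ} (hm : 3 ≤ m) {lam θ δ θ' δ' : ℝ} {z z' : ℕ}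
    (hz : z < m) (hz' : z' < m)
    (hθ : ((m : ℝ) - 1) * θ = z * Real.pi - 2 * δ) (hδ : |δ| < Real.pi / 2)
    (hlam : lam = 1 + Real.cos θ + Real.tan δ * Real.sin θ)
    (hθ' : ((m : ℝ) - 1) * θ' = z' * Real.pi - 2 * δ') (hδ' : |δ'| < Real.pi / 2)
    (hlam' : lam = 1 + Real.cos θ' + Real.tan δ' * Real.sin θ')
    (heq : Real.cos θ = Real.cos θ') : z = z' := by
  have hπ := Real.pi_pos
  by_cases hs : Real.sin θ = 0
  · have hs' : Real.sin θ' = 0 := by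
      have h1 := Real.sin_sq_add_cos_sq θ
      have h2 := Real.sin_sq_add_cos_sq θ'
      rw [hs, heq] at h1
      exact pow_eq_zero_iff (two_ne_zero) |>.mp (by linarith)
    rcases shift_angle_of_sin_eq_zero hm hz hθ hδ hs with ⟨rfl, h1⟩ | ⟨rfl, h1⟩ <;>
    rcases shift_angle_of_sin_eq_zero hm hz' hθ' hδ' hs' with ⟨rfl, h2⟩ | ⟨rfl, h2⟩
    · omega
    · norm_num at heq
    · norm_num at heq
    · omega
  have htan : Real.tan δ * Real.sin θ = Real.tan δ' * Real.sin θ' := by linarith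
  have hinj : ∀ {x y : ℝ}, |x| < Real.pi / 2 → |y| < Real.pi / 2 → Real.tan x = Real.tan y →
      x = y := fun hx hy h => Real.injOn_tan (abs_lt.mp hx) (abs_lt.mp hy) h
  -- a reflection of the angle reflects the shift
  have hneg : Real.sin θ' = -Real.sin θ → δ' = -δ := fun h => by
    refine hinj hδ' (by rwa [abs_neg]) ?_
    rw [Real.tan_neg]
    rw [h] at htan
    exact mul_right_cancel₀ hs (by linarith)
  obtain ⟨h1, h2⟩ := shift_angle_mem_Ioo hm hz hθ hδ
  obtain ⟨h1', h2'⟩ := shift_angle_mem_Ioo hm hz' hθ' hδ'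
  obtain ⟨k, hk | hk⟩ := Real.cos_eq_cos_iff.mp heq
  · have hk1 : (-1 : ℝ) < k := by by_contra! h; nlinarith
    have hk2 : (k : ℝ) < 1 := by by_contra! h; nlinarith
    have hk1' : -1 < k := by exact_mod_cast hk1
    have hk2' : k < 1 := by exact_mod_cast hk2
    obtain rfl : k = 0 := by omega
    obtain rfl : θ' = θ := by simpa using hk
    obtain rfl : δ = δ' := hinj hδ hδ' (mul_right_cancel₀ hs htan)
    have : (z : ℝ) * Real.pi = z' * Real.pi := by linarith
    exact_mod_cast mul_right_cancel₀ hπ.ne' this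
  · have hk1 : (-1 : ℝ) < k := by by_contra! h; nlinarith
    have hk2 : (k : ℝ) < 2 := by by_contra! h; nlinarith
    have hk1' : -1 < k := by exact_mod_cast hk1
    have hk2' : k < 2 := by exact_mod_cast hk2
    obtain rfl | rfl : k = 0 ∨ k = 1 := by omega
    · obtain rfl : θ' = -θ := by simpa using hk
      have hδδ := hneg (Real.sin_neg θ)
      have : ((z : ℝ) + z') * Real.pi = 0 * Real.pi := by rw [hδδ] at hθ'; linarith
      have := mul_right_cancel₀ hπ.ne' this
      have : z + z' = 0 := by exact_mod_cast this
      omega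
    · obtain rfl : θ' = 2 * Real.pi - θ := by simpa using hk
      have hδδ := hneg (Real.sin_two_pi_sub θ)
      have : ((z : ℝ) + z' + 2) * Real.pi = (2 * m) * Real.pi := by rw [hδδ] at hθ'; linarith
      have := mul_right_cancel₀ hπ.ne' this
      have : z + z' + 2 = 2 * m := by exact_mod_cast this
      omega

/-! ### Existence of shifts -/

/-- A monotone section of a continuous, not necessarily monotone function: the value at `t` is the
first point where `g` reaches the height `t`. -/
theorem exists_monotone_section {g : ℝ → ℝ} {a b : ℝ} (hab : a ≤ b)
    (hg : ContinuousOn g (Set.Icc a b)) :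
    ∃ φ : ℝ → ℝ, ∀ t ∈ Set.Icc (g a) (g b), φ t ∈ Set.Icc a b ∧ g (φ t) = t ∧
      ∀ s ∈ Set.Icc (g a) (g b), s ≤ t → φ s ≤ φ t := by
  let A : ℝ → Set ℝ := fun t => Set.Icc a b ∩ g ⁻¹' Set.Ici t
  have hbdd : ∀ t, BddBelow (A t) := fun t => ⟨a, fun x hx => hx.1.1⟩
  have hmem : ∀ t ≤ g b, sInf (A t) ∈ A t := fun t ht =>
    (hg.preimage_isClosed_of_isClosed isClosed_Icc isClosed_Ici).csInf_mem
      ⟨b, ⟨hab, le_rfl⟩, ht⟩ (hbdd t)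
  refine ⟨fun t => sInf (A t), fun t ht => ⟨(hmem t ht.2).1, ?_, fun s hs hst => ?_⟩⟩
  · obtain ⟨hx, hgx⟩ := hmem t ht.2
    change g (sInf (A t)) = t
    set x := sInf (A t)
    obtain ⟨y, hy, hgy⟩ := intermediate_value_Icc hx.1
      (hg.mono (Set.Icc_subset_Icc_right hx.2)) (show t ∈ Set.Icc (g a) (g x) from ⟨ht.1, hgx⟩)
    have : x ≤ y := csInf_le (hbdd t) ⟨⟨hy.1, hy.2.trans hx.2⟩, hgy.ge⟩
    rw [le_antisymm this hy.2, hgy]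
  · exact csInf_le_csInf (hbdd s) ⟨_, hmem t ht.2⟩
      fun x hx => ⟨hx.1, hst.trans hx.2⟩

/-- In one dimension there is a shift for every value of `lam` in `[0, 2]`, and it can be chosen such
that the cosine of the angle is monotone in `lam`. -/
theorem exists_monotone_shift {m : ℕ} (hm : 2 ≤ m) {z : ℕ} (hz : z < m) :
    ∃ φ : ℝ → ℝ, ∀ t ∈ Set.Icc (0 : ℝ) 2, |φ t| < Real.pi / 2 ∧
      t = 1 + Real.cos ((z * Real.pi - 2 * φ t) / ((m : ℝ) - 1)) +
        Real.tan (φ t) * Real.sin ((z * Real.pi - 2 * φ t) / ((m : ℝ) - 1)) ∧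
      ∀ s ∈ Set.Icc (0 : ℝ) 2, s ≤ t →
        Real.cos ((z * Real.pi - 2 * φ s) / ((m : ℝ) - 1)) ≤
          Real.cos ((z * Real.pi - 2 * φ t) / ((m : ℝ) - 1)) := by
  have hπ := Real.pi_pos
  have hm' : (2 : ℝ) ≤ m := by exact_mod_cast hm
  have hz' : (z : ℝ) + 1 ≤ m := by exact_mod_cast hz
  have hz0 : (0 : ℝ) ≤ z := Nat.cast_nonneg z
  have hM : (0 : ℝ) < (m : ℝ) - 1 := by linarith
  set T : ℝ → ℝ := fun x => (z * Real.pi - 2 * x) / ((m : ℝ) - 1) with hT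
  -- the angle at `a` is `π + 2 a` and the angle at `b` is `2 b`, where `lam` is `0` and `2`
  set a : ℝ := ((z : ℝ) + 1 - m) * Real.pi / (2 * m) with ha
  set b : ℝ := (z : ℝ) * Real.pi / (2 * m) with hb
  have hTa : T a = Real.pi + 2 * a := by
    simp only [hT, ha]; field_simp; ring
  have hTb : T b = 2 * b := by
    simp only [hT, hb]; field_simp
  have ha1 : -(Real.pi / 2) < a := by
    rw [ha, lt_div_iff₀ (by linarith)]; nlinarith
  have ha0 : a ≤ 0 := by
    rw [ha]; exact div_nonpos_of_nonpos_of_nonneg (by nlinarith) (by linarith)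
  have hb0 : 0 ≤ b := by rw [hb]; positivity
  have hb1 : b < Real.pi / 2 := by
    rw [hb, div_lt_iff₀ (by linarith)]; nlinarith
  have hanti : ∀ x y, x ≤ y → T y ≤ T x := fun x y hxy =>
    div_le_div_of_nonneg_right (by linarith) hM.le
  have habs : ∀ x ∈ Set.Icc a b, |x| < Real.pi / 2 := fun x hx =>
    abs_lt.mpr ⟨ha1.trans_le hx.1, hx.2.trans_lt hb1⟩
  have hcos : ∀ x ∈ Set.Icc a b, Real.cos x ≠ 0 := fun x hx =>
    (Real.cos_pos_of_mem_Ioo (abs_lt.mp (habs x hx))).ne'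
  have htan : ∀ x ∈ Set.Icc a b, Real.tan x * Real.sin (2 * x) = 2 * Real.sin x ^ 2 := by
    intro x hx
    rw [Real.sin_two_mul]
    linear_combination 2 * Real.sin x * Real.tan_mul_cos (hcos x hx)
  have hab : a ≤ b := ha0.trans hb0
  have hg : ContinuousOn (fun x => 1 + Real.cos (T x) + Real.tan x * Real.sin (T x))
      (Set.Icc a b) := by
    have hTc : Continuous T := by fun_prop
    have h1 : ContinuousOn Real.tan (Set.Icc a b) :=
      Real.continuousOn_tan.mono fun x hx => hcos x hx
    fun_prop
  have hga : 1 + Real.cos (T a) + Real.tan a * Real.sin (T a) = 0 := by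
    have h1 : Real.cos (Real.pi + 2 * a) = -Real.cos (2 * a) := by
      rw [add_comm, Real.cos_add_pi]
    have h2 : Real.sin (Real.pi + 2 * a) = -Real.sin (2 * a) := by
      rw [add_comm, Real.sin_add_pi]
    rw [hTa, h1, h2, mul_neg, htan a ⟨le_rfl, hab⟩, Real.cos_two_mul, Real.cos_sq']
    ring
  have hgb : 1 + Real.cos (T b) + Real.tan b * Real.sin (T b) = 2 := by
    rw [hTb, htan b ⟨hab, le_rfl⟩, Real.cos_two_mul, Real.cos_sq']
    ring
  obtain ⟨φ, hφ⟩ := exists_monotone_section hab hg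
  simp only [hga, hgb] at hφ
  refine ⟨φ, fun t ht => ⟨habs _ (hφ t ht).1, (hφ t ht).2.1.symm, fun s hs hst => ?_⟩⟩
  have hs1 := (hφ s hs).1
  have ht1 := (hφ t ht).1
  refine Real.cos_le_cos_of_nonneg_of_le_pi ?_ ?_ (hanti _ _ ((hφ t ht).2.2 s hs hst))
  · have : T b ≤ T (φ t) := hanti _ _ ht1.2
    linarith
  · have : T (φ s) ≤ T a := hanti _ _ hs1.1
    linarith

/-! ### Sums over the grid -/

/-- The adjacency matrix of the grid is the Kronecker sum of those of the paths. -/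
theorem sum_neighborFinset_gridGraph {d : ℕ} {n : Fin d → ℕ} (x : GridVec n)
    (u : GridVec n → ℝ) :
    ∑ y ∈ (gridGraph n).neighborFinset x, u y =
      ∑ j, ∑ a, pathAdj (x j) a * u (Function.update x j a) := by
  have h1 : ∀ j, ∑ a, pathAdj (x j) a * u (Function.update x j a) =
      ∑ a ∈ Finset.univ.filter (fun a : Fin (n j) => ((x j : ℕ) + 1 = a ∨ (a : ℕ) + 1 = x j)),
        u (Function.update x j a) := fun j => by
    rw [Finset.sum_filter]
    simp only [pathAdj, ite_mul, one_mul, zero_mul]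
  simp_rw [h1]
  rw [Finset.sum_sigma']
  symm
  refine Finset.sum_bij (fun p _ => Function.update x p.1 p.2) ?_ ?_ ?_ (fun _ _ => rfl)
  · rintro ⟨j, a⟩ hp
    simp only [Finset.mem_sigma, Finset.mem_filter, Finset.mem_univ, true_and] at hp
    rw [SimpleGraph.mem_neighborFinset]
    exact ⟨j, by simpa using hp, fun i hi => by rw [Function.update_of_ne hi]⟩
  · rintro ⟨j, a⟩ hp ⟨k, b⟩ hq hpq
    simp only [Finset.mem_sigma, Finset.mem_filter, Finset.mem_univ, true_and] at hp hq
    have hj := congrFun hpq j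
    by_cases hjk : j = k
    · subst hjk
      simp only [Function.update_self] at hj
      rw [hj]
    · simp only [Function.update_self, Function.update_of_ne hjk] at hj
      rw [hj] at hp
      omega
  · intro y hy
    rw [SimpleGraph.mem_neighborFinset] at hy
    obtain ⟨j, hj, hi⟩ := hy
    refine ⟨⟨j, y j⟩, by simpa using hj, ?_⟩
    funext i
    by_cases hij : i = j
    · subst hij; simp
    · simp only [Function.update_of_ne hij, hi i hij]

theorem degree_gridGraph {d : ℕ} {n : Fin d → ℕ} (x : GridVec n) :
    ((gridGraph n).degree x : ℝ) = ∑ j, pathDeg (x j) := by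
  have := sum_neighborFinset_gridGraph x (fun _ => (1 : ℝ))
  simpa [pathDeg] using this

theorem degree_gridGraph_pos {d : ℕ} (hd : 0 < d) {n : Fin d → ℕ} (hn : ∀ j, 2 ≤ n j)
    (x : GridVec n) : 0 < ((gridGraph n).degree x : ℝ) := by
  rw [degree_gridGraph]
  exact Finset.sum_pos (fun j _ => one_pos.trans_le (one_le_pathDeg (hn j) _))
    ⟨⟨0, hd⟩, Finset.mem_univ _⟩

theorem sum_prod_gridVec {d : ℕ} {n : Fin d → ℕ} (h : (j : Fin d) → Fin (n j) → ℝ) :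
    ∑ x : GridVec n, ∏ j, h j (x j) = ∏ j, ∑ a, h j a := by
  rw [Finset.prod_univ_sum, Fintype.piFinset_univ]

theorem gridAngle_mul {d : ℕ} {n : Fin d → ℕ} (hn : ∀ j, 2 ≤ n j) (z : GridVec n)
    (δ : Fin d → ℝ) (j : Fin d) :
    ((n j : ℝ) - 1) * gridAngle z δ j = ((z j : ℕ) : ℝ) * Real.pi - 2 * δ j := by
  have : (2 : ℝ) ≤ n j := by exact_mod_cast hn j
  unfold gridAngle
  field_simp [show (n j : ℝ) - 1 ≠ 0 by linarith]

/-! ### Eigenvectors -/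

/-- The eigenvector without the factor `D ^ (1/2)`. -/
def gridWave {d : ℕ} {n : Fin d → ℕ} (z : GridVec n) (δ : Fin d → ℝ) : GridVec n → ℝ :=
  fun x => ∏ j, shiftWave (gridAngle z δ j) (δ j) (x j)

theorem gridEigenvector_apply {d : ℕ} {n : Fin d → ℕ} (z : GridVec n) (δ : Fin d → ℝ)
    (x : GridVec n) :
    gridEigenvector z δ x = √((gridGraph n).degree x : ℝ) * gridWave z δ x := rfl

theorem lapMatrix_mulVec_gridWave {d : ℕ} {n : Fin d → ℕ} (hn : ∀ j, 2 ≤ n j) {z : GridVec n}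
    {lam : ℝ} {δ : Fin d → ℝ} (h : IsShiftSolution z lam δ) (x : GridVec n) :
    ((gridGraph n).lapMatrix ℝ *ᵥ gridWave z δ) x =
      lam * ((gridGraph n).degree x * gridWave z δ x) := by
  rw [SimpleGraph.lapMatrix_mulVec_apply, sum_neighborFinset_gridGraph]
  have hj : ∀ j, ∑ a, pathAdj (x j) a * gridWave z δ (Function.update x j a) =
      ((1 - lam) * pathDeg (x j) + (2 * (lam - 1) - 2 * Real.cos (gridAngle z δ j))) *
        gridWave z δ x := by
    intro j
    have hP : ∀ y : GridVec n, gridWave z δ y = shiftWave (gridAngle z δ j) (δ j) (y j) *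
        ∏ i ∈ Finset.univ.erase j, shiftWave (gridAngle z δ i) (δ i) (y i) := fun y =>
      (Finset.mul_prod_erase _ _ (Finset.mem_univ j)).symm
    have hQ : ∀ a, ∏ i ∈ Finset.univ.erase j,
        shiftWave (gridAngle z δ i) (δ i) (Function.update x j a i) =
        ∏ i ∈ Finset.univ.erase j, shiftWave (gridAngle z δ i) (δ i) (x i) := fun a =>
      Finset.prod_congr rfl fun i hi => by
        rw [Function.update_of_ne (Finset.ne_of_mem_erase hi)]
    simp_rw [hP, hQ, Function.update_self, ← mul_assoc]
    rw [← Finset.sum_mul, sum_pathAdj_shiftWave (hn j) (gridAngle_mul hn z δ j) (h.2 j).1 (h.2 j).2]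
  simp_rw [hj]
  rw [← Finset.sum_mul, degree_gridGraph, Finset.sum_add_distrib, ← Finset.mul_sum]
  -- the eigenvalues on the paths cancel by the first equation of the system
  have h0 : ∑ j, (2 * (lam - 1) - 2 * Real.cos (gridAngle z δ j)) = 0 := by
    have := h.1
    rw [Finset.sum_add_distrib] at this
    rw [Finset.sum_sub_distrib]
    simp at this ⊢
    linarith
  rw [h0]; ring

theorem gridEigenvector_ne_zero {d : ℕ} (hd : 0 < d) {n : Fin d → ℕ} (hn : ∀ j, 2 ≤ n j)
    {z : GridVec n} {lam : ℝ} {δ : Fin d → ℝ} (h : IsShiftSolution z lam δ) :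
    gridEigenvector z δ ≠ 0 := by
  intro h0
  -- the corner
  have := congrFun h0 (fun j => ⟨0, by have := hn j; omega⟩)
  rw [gridEigenvector_apply] at this
  refine mul_ne_zero (Real.sqrt_ne_zero'.mpr (degree_gridGraph_pos hd hn _)) ?_ this
  refine Finset.prod_ne_zero_iff.mpr fun j _ => ?_
  simpa [shiftWave] using (h.2 j).1

theorem gridNormLaplacian_mulVec {d : ℕ} (hd : 0 < d) {n : Fin d → ℕ} (hn : ∀ j, 2 ≤ n j)
    {z : GridVec n} {lam : ℝ} {δ : Fin d → ℝ} (h : IsShiftSolution z lam δ) :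
    gridNormLaplacian n *ᵥ gridEigenvector z δ = lam • gridEigenvector z δ := by
  have hs : ∀ x : GridVec n, √((gridGraph n).degree x : ℝ) ≠ 0 := fun x =>
    Real.sqrt_ne_zero'.mpr (degree_gridGraph_pos hd hn _)
  have h1 : Matrix.diagonal (fun x => (√((gridGraph n).degree x : ℝ))⁻¹) *ᵥ
      gridEigenvector z δ = gridWave z δ := by
    ext x
    rw [Matrix.mulVec_diagonal, gridEigenvector_apply, inv_mul_cancel_left₀ (hs x)]
  unfold gridNormLaplacian
  rw [← Matrix.mulVec_mulVec, h1, ← Matrix.mulVec_mulVec]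
  ext x
  rw [Matrix.mulVec_diagonal, lapMatrix_mulVec_gridWave hn h, Pi.smul_apply, smul_eq_mul,
    gridEigenvector_apply]
  have hsq : (√((gridGraph n).degree x : ℝ))⁻¹ * (gridGraph n).degree x =
      √((gridGraph n).degree x : ℝ) := by
    rw [inv_mul_eq_iff_eq_mul₀ (hs x), Real.mul_self_sqrt (Nat.cast_nonneg _)]
  linear_combination lam * gridWave z δ x * hsq

theorem gridNormLaplacian_transpose {d : ℕ} (n : Fin d → ℕ) :
    (gridNormLaplacian n)ᵀ = gridNormLaplacian n := by
  unfold gridNormLaplacian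
  rw [Matrix.transpose_mul, Matrix.transpose_mul, Matrix.diagonal_transpose,
    (SimpleGraph.isSymm_lapMatrix (R := ℝ) (gridGraph n)).eq, Matrix.mul_assoc]

theorem dotProduct_eq_zero_of_ne {ι : Type*} [Fintype ι] {M : Matrix ι ι ℝ} (hM : Mᵀ = M)
    {v w : ι → ℝ} {a b : ℝ} (hv : M *ᵥ v = a • v) (hw : M *ᵥ w = b • w) (hab : a ≠ b) :
    v ⬝ᵥ w = 0 := by
  have h1 : (M *ᵥ v) ⬝ᵥ w = v ⬝ᵥ (M *ᵥ w) := by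
    rw [Matrix.dotProduct_mulVec, ← Matrix.mulVec_transpose, hM]
  rw [hv, hw, smul_dotProduct, dotProduct_smul, smul_eq_mul, smul_eq_mul] at h1
  have : (a - b) * (v ⬝ᵥ w) = 0 := by linarith
  exact (mul_eq_zero.mp this).resolve_left (sub_ne_zero.mpr hab)

/-- The degree is a sum over the dimensions `i`; for each of them the sum over the nodes factors. -/
theorem gridEigenvector_dotProduct {d : ℕ} {n : Fin d → ℕ} (z z' : GridVec n)
    (δ δ' : Fin d → ℝ) :
    gridEigenvector z δ ⬝ᵥ gridEigenvector z' δ' =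
      ∑ i, ∏ j, ∑ a : Fin (n j), (if j = i then pathDeg a else 1) *
        (shiftWave (gridAngle z δ j) (δ j) a * shiftWave (gridAngle z' δ' j) (δ' j) a) := by
  simp_rw [← sum_prod_gridVec]
  rw [Finset.sum_comm]
  refine Finset.sum_congr rfl fun x _ => ?_
  simp_rw [Finset.prod_mul_distrib]
  rw [← Finset.sum_mul, gridEigenvector_apply, gridEigenvector_apply]
  have hd : ∑ i, ∏ j, (if j = i then pathDeg (x j) else 1) = ((gridGraph n).degree x : ℝ) := by
    simp [degree_gridGraph]
  rw [hd]
  have hsq : √((gridGraph n).degree x : ℝ) * √((gridGraph n).degree x : ℝ) =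
    (gridGraph n).degree x := Real.mul_self_sqrt (Nat.cast_nonneg _)
  unfold gridWave
  linear_combination (∏ j, shiftWave (gridAngle z δ j) (δ j) (x j)) *
    (∏ j, shiftWave (gridAngle z' δ' j) (δ' j) (x j)) * hsq

/-- The angles of two solutions cannot differ in the cosine in one dimension only, as the cosines
have the same sum. So every term of the dot product has a vanishing factor. -/
theorem gridEigenvector_orthogonal_of_cos_ne {d : ℕ} (hd : 0 < d) {n : Fin d → ℕ}
    (hn : ∀ j, 2 ≤ n j) {z z' : GridVec n} {lam lam' : ℝ} {δ δ' : Fin d → ℝ}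
    (h : IsShiftSolution z lam δ) (h' : IsShiftSolution z' lam' δ')
    (hne : lam = lam' → ∃ j, Real.cos (gridAngle z δ j) ≠ Real.cos (gridAngle z' δ' j)) :
    gridEigenvector z δ ⬝ᵥ gridEigenvector z' δ' = 0 := by
  by_cases hl : lam = lam'
  swap
  · exact dotProduct_eq_zero_of_ne (gridNormLaplacian_transpose n)
      (gridNormLaplacian_mulVec hd hn h) (gridNormLaplacian_mulVec hd hn h') hl
  obtain ⟨j, hj⟩ := hne hl
  subst hl
  rw [gridEigenvector_dotProduct]
  refine Finset.sum_eq_zero fun i _ => ?_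
  obtain ⟨k, hki, hk⟩ : ∃ k, k ≠ i ∧
      Real.cos (gridAngle z δ k) ≠ Real.cos (gridAngle z' δ' k) := by
    by_contra! hcon
    -- if only the cosines in dimension `i` could differ, the equal sums would make them equal too
    have hsum := h.1.symm.trans h'.1
    rw [← sub_eq_zero, ← Finset.sum_sub_distrib,
      Finset.sum_eq_single i (fun k _ hk => by rw [hcon k hk, sub_self])
        (fun hi => absurd (Finset.mem_univ i) hi)] at hsum
    by_cases hji : j = i
    · subst hji
      exact hj (by linarith)
    · exact hj (hcon j hji)
  refine Finset.prod_eq_zero (Finset.mem_univ k) ?_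
  simp only [hki, if_false, one_mul]
  exact sum_shiftWave_mul_eq_zero (hn k) (gridAngle_mul hn z δ k) (h.2 k).1 (h.2 k).2
    (gridAngle_mul hn z' δ' k) (h'.2 k).1 (h'.2 k).2 hk

theorem gridEigenvector_proportional {d : ℕ} {n : Fin d → ℕ} {z z' : GridVec n} {lam : ℝ}
    {δ δ' : Fin d → ℝ} (h : IsShiftSolution z lam δ) (h' : IsShiftSolution z' lam δ')
    (heq : ∀ j, Real.cos (gridAngle z δ j) = Real.cos (gridAngle z' δ' j)) :
    gridEigenvector z' δ' = (∏ j, Real.cos (δ' j) / Real.cos (δ j)) • gridEigenvector z δ := by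
  ext x
  rw [Pi.smul_apply, smul_eq_mul, gridEigenvector_apply, gridEigenvector_apply]
  unfold gridWave
  rw [mul_left_comm, ← Finset.prod_mul_distrib]
  congr 1
  refine Finset.prod_congr rfl fun j _ => ?_
  have := cos_mul_shiftWave_eq (h.2 j).1 (h.2 j).2 (h'.2 j).1 (h'.2 j).2 (heq j) (x j)
  field_simp [(h.2 j).1]
  linarith

theorem gridEigenvector_orthogonal_of_ne {d : ℕ} (hd : 0 < d) {n : Fin d → ℕ}
    (hn : ∀ j, 3 ≤ n j) {z z' : GridVec n} {lam lam' : ℝ} {δ δ' : Fin d → ℝ}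
    (hδ : ∀ j, |δ j| < Real.pi / 2) (h : IsShiftSolution z lam δ)
    (hδ' : ∀ j, |δ' j| < Real.pi / 2) (h' : IsShiftSolution z' lam' δ') (hne : z ≠ z') :
    gridEigenvector z δ ⬝ᵥ gridEigenvector z' δ' = 0 := by
  have hn2 : ∀ j, 2 ≤ n j := fun j => (by norm_num : 2 ≤ 3).trans (hn j)
  refine gridEigenvector_orthogonal_of_cos_ne hd hn2 h h' fun hl => ?_
  subst hl
  by_contra! hcon
  refine hne (funext fun j => Fin.ext ?_)
  exact nat_eq_of_cos_eq (hn j) (z j).2 (z' j).2 (gridAngle_mul hn2 z δ j) (hδ j) (h.2 j).2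
    (gridAngle_mul hn2 z' δ' j) (hδ' j) (h'.2 j).2 (hcon j)

theorem cos_ne_zero_of_abs_lt {δ : ℝ} (h : |δ| < Real.pi / 2) : Real.cos δ ≠ 0 :=
  (Real.cos_pos_of_mem_Ioo (abs_lt.mp h)).ne'

/-- With shifts that solve the equations number `1, …, d` and depend monotonically on `lam`, the
remaining equation asks for a fixed point of a monotone self-map of `[0, 2]`. -/
theorem exists_isShiftSolution {d : ℕ} (hd : 0 < d) {n : Fin d → ℕ} (hn : ∀ j, 2 ≤ n j)
    (z : GridVec n) :
    ∃ (lam : ℝ) (δ : Fin d → ℝ), (∀ j, |δ j| < Real.pi / 2) ∧ IsShiftSolution z lam δ := by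
  choose φ hφ using fun j => exists_monotone_shift (hn j) (z j).2
  have hd' : (0 : ℝ) < d := by exact_mod_cast hd
  let F : ℝ → ℝ := fun t => (∑ j, (1 + Real.cos (gridAngle z (fun j => φ j t) j))) / d
  have hF : ∀ t, F t ∈ Set.Icc (0 : ℝ) 2 := by
    intro t
    constructor
    · refine div_nonneg (Finset.sum_nonneg fun j _ => ?_) hd'.le
      linarith [Real.neg_one_le_cos (gridAngle z (fun j => φ j t) j)]
    · rw [div_le_iff₀ hd']
      refine (Finset.sum_le_card_nsmul _ _ 2 fun j _ => ?_).trans (by simp [mul_comm])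
      linarith [Real.cos_le_one (gridAngle z (fun j => φ j t) j)]
  have hmono : ∀ s ∈ Set.Icc (0 : ℝ) 2, ∀ t ∈ Set.Icc (0 : ℝ) 2, s ≤ t → F s ≤ F t := by
    intro s hs t ht hst
    refine div_le_div_of_nonneg_right (Finset.sum_le_sum fun j _ => ?_) hd'.le
    have := (hφ j t ht).2.2 s hs hst
    unfold gridAngle
    linarith
  have : Fact ((0 : ℝ) ≤ 2) := ⟨by norm_num⟩
  let f : Set.Icc (0 : ℝ) 2 →o Set.Icc (0 : ℝ) 2 :=
    ⟨fun t => ⟨F t, hF t⟩, fun s t hst => hmono s s.2 t t.2 hst⟩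
  have hfix : f (OrderHom.lfp f) = OrderHom.lfp f := OrderHom.map_lfp f
  set t := OrderHom.lfp f
  have hFt : F t = t := congrArg Subtype.val hfix
  refine ⟨t, fun j => φ j t, fun j => (hφ j t t.2).1, ?_, fun j =>
    ⟨cos_ne_zero_of_abs_lt (hφ j t t.2).1, (hφ j t t.2).2.1⟩⟩
  have h1 : ∑ j, (1 + Real.cos (gridAngle z (fun j => φ j t) j)) = d * t := by
    have := hFt
    simp only [F] at this
    field_simp at this
    linarith
  have h2 : ∑ j, (2 + 2 * Real.cos (gridAngle z (fun j => φ j (t : ℝ)) j)) =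
      2 * ∑ j, (1 + Real.cos (gridAngle z (fun j => φ j t) j)) := by
    rw [Finset.mul_sum]
    exact Finset.sum_congr rfl fun j _ => by ring
  rw [h2, h1]; ring

/-! ### Complete orthogonal systems -/

theorem linearIndependent_of_dotProduct {ι κ : Type*} [Fintype ι] [Fintype κ] {v : κ → ι → ℝ}
    (h0 : ∀ k, v k ≠ 0) (ho : ∀ k l, k ≠ l → v k ⬝ᵥ v l = 0) : LinearIndependent ℝ v := by
  rw [Fintype.linearIndependent_iff]
  intro g hg k
  have h1 : (∑ l, g l • v l) ⬝ᵥ v k = g k * (v k ⬝ᵥ v k) := by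
    rw [sum_dotProduct, Finset.sum_eq_single k]
    · rw [smul_dotProduct, smul_eq_mul]
    · intro l _ hl
      rw [smul_dotProduct, ho l k hl, smul_zero]
    · simp
  rw [hg, zero_dotProduct] at h1
  exact (mul_eq_zero.mp h1.symm).resolve_right fun h => h0 k (dotProduct_self_eq_zero.mp h)

theorem span_eq_top_of_dotProduct {ι : Type*} [Fintype ι] [Nonempty ι] {v : ι → ι → ℝ}
    (h0 : ∀ k, v k ≠ 0) (ho : ∀ k l, k ≠ l → v k ⬝ᵥ v l = 0) :
    Submodule.span ℝ (Set.range v) = ⊤ :=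
  (linearIndependent_of_dotProduct h0 ho).span_eq_top_of_card_eq_finrank
    (Module.finrank_fintype_fun_eq_card ℝ).symm

theorem eq_zero_of_dotProduct_eq_zero {ι : Type*} [Fintype ι] [Nonempty ι] {v : ι → ι → ℝ}
    (h0 : ∀ k, v k ≠ 0) (ho : ∀ k l, k ≠ l → v k ⬝ᵥ v l = 0) {w : ι → ℝ}
    (hw : ∀ k, w ⬝ᵥ v k = 0) : w = 0 := by
  have hmem : w ∈ Submodule.span ℝ (Set.range v) := by
    rw [span_eq_top_of_dotProduct h0 ho]; trivial
  refine dotProduct_self_eq_zero.mp ?_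
  refine Submodule.span_induction (p := fun y _ => w ⬝ᵥ y = 0) ?_ ?_ ?_ ?_ hmem
  · rintro _ ⟨k, rfl⟩; exact hw k
  · exact dotProduct_zero w
  · intro x y _ _ hx hy; rw [dotProduct_add, hx, hy, add_zero]
  · intro c x _ hx; rw [dotProduct_smul, hx, smul_zero]

end

theorem mainTheorem3 (d : ℕ) (hd : 0 < d) (n : Fin d → ℕ)
    (hinner : ∃ x : GridVec n, IsInnerNode x) :
    -- every solution of the system yields an eigenvalue of the stated form and an eigenvector
    (∀ (z : GridVec n) (lam : ℝ) (δ : Fin d → ℝ), IsShiftSolution z lam δ →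
      lam = 1 + 1 / (d : ℝ) *
        ∑ j, Real.cos (1 / ((n j : ℝ) - 1) * (((z j : ℕ) : ℝ) * Real.pi - 2 * δ j)) ∧
      Module.End.HasEigenvector (Matrix.toLin' (gridNormLaplacian n)) lam
        (gridEigenvector z δ)) ∧
    -- eigenvectors that come from two solutions are orthogonal, unless they are proportional
    (∀ (z z' : GridVec n) (lam lam' : ℝ) (δ δ' : Fin d → ℝ),
      IsShiftSolution z lam δ → IsShiftSolution z' lam' δ' →
      gridEigenvector z δ ⬝ᵥ gridEigenvector z' δ' = 0 ∨
        ∃ c : ℝ, gridEigenvector z' δ' = c • gridEigenvector z δ) ∧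
    -- for every `z` the system is solvable with all shifts in `(-π/2, π/2)`, for just one eigenvalue
    (∀ z : GridVec n, ∃! lam : ℝ, ∃ δ : Fin d → ℝ,
      (∀ j, |δ j| < Real.pi / 2) ∧ IsShiftSolution z lam δ) ∧
    -- such solutions, one for each `z`, yield a complete orthogonal system of eigenvectors
    (∀ (lam : GridVec n → ℝ) (δ : GridVec n → Fin d → ℝ),
      (∀ z, (∀ j, |δ z j| < Real.pi / 2) ∧ IsShiftSolution z (lam z) (δ z)) →
      (∀ z z', z ≠ z' → gridEigenvector z (δ z) ⬝ᵥ gridEigenvector z' (δ z') = 0) ∧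
      LinearIndependent ℝ (fun z => gridEigenvector z (δ z)) ∧
      Submodule.span ℝ (Set.range fun z => gridEigenvector z (δ z)) = ⊤ ∧
      ∀ a : ℝ, Module.End.HasEigenvalue (Matrix.toLin' (gridNormLaplacian n)) a ↔
        ∃ z, lam z = a) := by
  have hn : ∀ j, 3 ≤ n j := fun j => by
    obtain ⟨x, hx⟩ := hinner
    have := hx j
    omega
  have hn2 : ∀ j, 2 ≤ n j := fun j => (by norm_num : 2 ≤ 3).trans (hn j)
  have : Nonempty (GridVec n) := ⟨hinner.choose⟩
  have hd' : (d : ℝ) ≠ 0 := by exact_mod_cast hd.ne'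
  refine ⟨fun z lam δ h => ⟨?_, ?_⟩, fun z z' lam lam' δ δ' h h' => ?_, fun z => ?_,
    fun lam δ h => ?_⟩
  · have h1 := h.1
    rw [Finset.sum_add_distrib, ← Finset.mul_sum] at h1
    have h2 : ∀ j, 1 / ((n j : ℝ) - 1) * (((z j : ℕ) : ℝ) * Real.pi - 2 * δ j) =
        gridAngle z δ j := fun j => by unfold gridAngle; ring
    simp_rw [h2]
    simp at h1
    field_simp
    linarith
  · exact Module.End.hasEigenvector_iff.mpr ⟨Module.End.mem_eigenspace_iff.mpr (by
      rw [Matrix.toLin'_apply]; exact gridNormLaplacian_mulVec hd hn2 h),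
      gridEigenvector_ne_zero hd hn2 h⟩
  · by_cases hc : lam = lam' → ∃ j, Real.cos (gridAngle z δ j) ≠ Real.cos (gridAngle z' δ' j)
    · exact Or.inl (gridEigenvector_orthogonal_of_cos_ne hd hn2 h h' hc)
    · push Not at hc
      obtain ⟨rfl, hc⟩ := hc
      exact Or.inr ⟨_, gridEigenvector_proportional h h' hc⟩
  · choose lam δ h using fun z : GridVec n => exists_isShiftSolution hd hn2 z
    refine ⟨lam z, ⟨δ z, h z⟩, ?_⟩
    rintro lam' ⟨δ', hδ', h'⟩
    -- otherwise the eigenvector for `lam'` is orthogonal to a complete system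
    by_contra hne
    refine gridEigenvector_ne_zero hd hn2 h' (eq_zero_of_dotProduct_eq_zero
      (v := fun y => gridEigenvector y (δ y))
      (fun y => gridEigenvector_ne_zero hd hn2 (h y).2)
      (fun y y' hy => gridEigenvector_orthogonal_of_ne hd hn (h y).1 (h y).2 (h y').1 (h y').2 hy)
      fun y => ?_)
    by_cases hy : z = y
    · subst hy
      exact gridEigenvector_orthogonal_of_cos_ne hd hn2 h' (h z).2 fun e => absurd e hne
    · exact gridEigenvector_orthogonal_of_ne hd hn hδ' h' (h y).1 (h y).2 hy
  · have h0 : ∀ z, gridEigenvector z (δ z) ≠ 0 := fun z =>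
      gridEigenvector_ne_zero hd hn2 (h z).2
    have ho : ∀ z z', z ≠ z' → gridEigenvector z (δ z) ⬝ᵥ gridEigenvector z' (δ z') = 0 :=
      fun y y' hy => gridEigenvector_orthogonal_of_ne hd hn (h y).1 (h y).2 (h y').1 (h y').2 hy
    refine ⟨ho, linearIndependent_of_dotProduct h0 ho, span_eq_top_of_dotProduct h0 ho,
      fun a => ⟨fun ha => ?_, ?_⟩⟩
    · obtain ⟨w, hw⟩ := ha.exists_hasEigenvector
      by_contra! hcon
      refine hw.2 (eq_zero_of_dotProduct_eq_zero h0 ho fun z => ?_)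
      have hw1 := hw.apply_eq_smul
      rw [Matrix.toLin'_apply] at hw1
      exact dotProduct_eq_zero_of_ne (gridNormLaplacian_transpose n) hw1
        (gridNormLaplacian_mulVec hd hn2 (h z).2) (hcon z).symm
    · rintro ⟨z, rfl⟩
      refine Module.End.hasEigenvalue_of_hasEigenvector (x := gridEigenvector z (δ z)) ?_
      exact Module.End.hasEigenvector_iff.mpr ⟨Module.End.mem_eigenspace_iff.mpr (by
        rw [Matrix.toLin'_apply]; exact gridNormLaplacian_mulVec hd hn2 (h z).2), h0 z⟩
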